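/- Let $S^1$ be a circle of length $T>0$, let $L^2(S^1)$ be the real Hilbert space of square integrable functions on it, with inner product $\oint\varphi\psi\,d\tau$, and let $e_m$, $m\in\mathbb Z$, be its trigonometric orthonormal basis: $e_m=\sqrt{2/T}\,\sin(2\pi\tau|m|/T)$ for $m<0$, $e_0=\sqrt{1/T}$, and $e_m=\sqrt{2/T}\,\cos(2\pi\tau m/T)$ for $m>0$. Let $\gamma\neq0$ be real, let $k\in L^2(S^1)$, $k\ne0$, let $L^2_{\perp k}(S^1)=\{\varphi\in L^2(S^1):\oint k\varphi=0\}$, and let $f$ be a complex functional on $L^2(S^1)$. Conventions. For a finite-dimensional subspace $V$ with orthonormal basis $b_1,\dots,b_d$ put $$\int_V D\varphi\,f[\varphi]=\lim_{\epsilon\to0+}\int_{\mathbb R^d}\prod_{i=1}^d\frac{dc_i}{\sqrt{2\pi}}\;f[\varphi]\,e^{-\frac\epsilon2\oint\varphi^2},\qquad \varphi=\sum_i c_ib_i ,$$ and let $\int_V D\varphi\,\delta(\gamma\oint k\varphi)f[\varphi]$ be defined in the same way, where for each $\epsilon>0$ the Dirac delta function $\delta(s)$ is the common limit, as $t\to0+$,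 of the nascent delta functions $t^{-1}\eta(s/t)$, with $\eta$ continuous, compactly supported and $\int_{\mathbb R}\eta=1$. Call $f$ tame on $V$ if it is continuous on $V$ and, for every $\epsilon>0$, $f[\varphi]\,e^{-\epsilon\oint\varphi^2}$ is bounded on $V$. An exhaustion of a closed subspace $K$ is an increasing sequence of finite-dimensional subspaces $V_n$ whose union is dense in $K$. For a sequence $V_n$ of finite-dimensional subspaces and complex numbers $Z_n$, the path integral of $f$ (or of $\delta(\gamma\oint k\varphi)f$) along $(V_n)$, renormalized by $(Z_n)$, is $\lim_{n\to\infty}Z_n\int_{V_n}D\varphi\,(\dots)$, where the integral over $V_n$ has to exist for all large $n$. With $V_n=\mathrm{span}\{e_m:|m|\le n\}$ and $Z_n=1$ this is the integral with the measure $\prod_{m\in\mathbb Z}d\varphi_m/\sqrt{2\pi}$, $\varphi=\sum_m\varphi_me_m$; in particular $\int D\varphi\,e^{-\frac12\oint\varphi^2}=1$. The intrinsic path integral $\int_K D\varphi$ exists and equals $I$ if, for every exhaustion of $K$, the path integral along it with all $Z_n=1$ exists and equals $I$. Theorem. In each of the three cases below $$\sqrt{2\pi}\int_{L^2(S^1)}D\varphi\;\delta\Big(\gamma\oint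 k\varphi\Big)f[\varphi]\;=\;\frac1{\sqrt{\gamma^2\oint k^2}}\int_{L^2_{\perp k}(S^1)}D\varphi_{\perp k}\;f[\varphi_{\perp k}]$$ in the sense that one of the two path integrals exists if and only if the other does, and then the equation holds. 1. $f$ is tame on $V_n=\mathrm{span}\{e_m:|m|\le n\}$ for every $n$; the left integral is taken along $(V_n)$ and the right one along $(V_n\cap L^2_{\perp k}(S^1))$, both renormalized by the same arbitrary sequence $(Z_n)$. 2. The same with any exhaustion $(V_n)$ of $L^2(S^1)$ such that $f$ is tame on every $V_n$. 3. $f$ is tame on every finite-dimensional subspace of $L^2(S^1)$, and both integrals are the intrinsic ones, so that independent orthonormal modes may be used in $L^2(S^1)$ and in $L^2_{\perp k}(S^1)$. -/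

import Mathlib

open MeasureTheory Filter Topology

noncomputable section

/-! ### Square integrable functions on a circle -/

/-- Real square integrable functions on a circle of length `T`. The measure is `dτ`, of total
mass `T`, so that the inner product is `∮ φ ψ`. -/
abbrev L2Circle (T : ℝ) [Fact (0 < T)] : Type :=
  Lp ℝ 2 (volume : Measure (AddCircle T))

/-- The trigonometric orthonormal basis: `√(2/T) sin (2πτ|m|/T)` for `m < 0`, `√(1/T)` for
`m = 0` and `√(2/T) cos (2πτm/T)` for `m > 0`, as continuous functions.
(`fourier n τ = exp (2πi n τ / T)`.) -/
def trigFun (T : ℝ) [Fact (0 < T)] (m : ℤ) : C(AddCircle T, ℝ) :=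
  if m < 0 then ⟨fun τ => √(2 / T) * (fourier (-m) τ).im, by fun_prop⟩
  else if m = 0 then ⟨fun _ => √(1 / T), by fun_prop⟩
  else ⟨fun τ => √(2 / T) * (fourier m τ).re, by fun_prop⟩

/-- The trigonometric orthonormal basis as a family of elements of `L²(S¹)`. -/
def trigMode (T : ℝ) [Fact (0 < T)] (m : ℤ) : L2Circle T :=
  ContinuousMap.toLp (E := ℝ) 2 (volume : Measure (AddCircle T)) ℝ (trigFun T m)

/-- The span of the modes `e_m` with `|m| ≤ N`. -/
def trigCutoff (T : ℝ) [Fact (0 < T)] (N : ℕ) : Submodule ℝ (L2Circle T) :=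
  Submodule.span ℝ (trigMode T '' Set.Icc (-(N : ℤ)) N)

instance trigCutoff_finiteDimensional (T : ℝ) [Fact (0 < T)] (N : ℕ) :
    FiniteDimensional ℝ (trigCutoff T N) :=
  FiniteDimensional.span_of_finite ℝ ((Set.finite_Icc _ _).image _)

/-! ### Integrals over finitely many modes -/

section Modes

variable {E : Type*} [NormedAddCommGroup E] [InnerProductSpace ℝ E]

/-- The element `∑ c_i b_i` of a finite-dimensional space `V` of modes, where `b` is an
orthonormal basis of `V`. -/
def modeSum (V : Submodule ℝ E) [FiniteDimensional ℝ V]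
    (c : EuclideanSpace ℝ (Fin (Module.finrank ℝ V))) : E :=
  ((∑ i, c i • stdOrthonormalBasis ℝ V i : V) : E)

/-- `∫ ∏ᵢ dcᵢ / √(2π)  F[∑ cᵢ bᵢ]` over a finite-dimensional space `V` of modes. By the rotation
invariance of Lebesgue measure this does not depend on the orthonormal basis `b` of `V`. -/
def modeIntegral (V : Submodule ℝ E) [FiniteDimensional ℝ V] (F : E → ℂ) : ℂ :=
  ((1 / √(2 * Real.pi)) ^ Module.finrank ℝ V : ℝ) *
    ∫ c : EuclideanSpace ℝ (Fin (Module.finrank ℝ V)), F (modeSum V c)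

/-- The integral `modeIntegral V F` converges absolutely. -/
def ModeIntegrable (V : Submodule ℝ E) [FiniteDimensional ℝ V] (F : E → ℂ) : Prop :=
  Integrable (fun c : EuclideanSpace ℝ (Fin (Module.finrank ℝ V)) => F (modeSum V c)) volume

/-- The functional `φ ↦ f[φ] exp (-ε/2 ‖φ‖²)`. -/
def gaussReg (ε : ℝ) (f : E → ℂ) (φ : E) : ℂ :=
  f φ * (Real.exp (-(ε / 2) * ‖φ‖ ^ 2) : ℝ)

/-- The integral of `f` over the modes in `V`, with the Gaussian convergence factor
`exp (-ε/2 ‖φ‖²)`, `ε → 0+`, exists and is `a`. (For absolutely integrable `f` it is the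
ordinary integral.) -/
def HasModeIntegral (V : Submodule ℝ E) [FiniteDimensional ℝ V] (f : E → ℂ) (a : ℂ) : Prop :=
  (∀ ε : ℝ, 0 < ε → ModeIntegrable V (gaussReg ε f)) ∧
    Tendsto (fun ε : ℝ => modeIntegral V (gaussReg ε f)) (𝓝[>] 0) (𝓝 a)

/-- Profiles `η` of nascent delta functions `t⁻¹ η(s / t) → δ(s)`, `t → 0+`. -/
def IsDeltaProfile (η : ℝ → ℝ) : Prop :=
  Continuous η ∧ HasCompactSupport η ∧ ∫ s, η s = 1

/-- The functional `φ ↦ t⁻¹ η(ℓ[φ] / t) F[φ]`, which approximates `δ(ℓ[φ]) F[φ]`. -/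
def smearedDelta (η : ℝ → ℝ) (t : ℝ) (l : E → ℝ) (F : E → ℂ) (φ : E) : ℂ :=
  ((t⁻¹ * η (l φ / t) : ℝ) : ℂ) * F φ

/-- The integral of `δ(ℓ[φ]) F[φ]` over the modes in `V` exists and is `a`: here `δ` is the Dirac
delta function on the line, the common limit of all the nascent delta functions. -/
def HasModeDelta (V : Submodule ℝ E) [FiniteDimensional ℝ V] (l : E → ℝ) (F : E → ℂ) (a : ℂ) :
    Prop :=
  ∀ η : ℝ → ℝ, IsDeltaProfile η →
    (∀ t : ℝ, 0 < t → ModeIntegrable V (smearedDelta η t l F)) ∧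
      Tendsto (fun t : ℝ => modeIntegral V (smearedDelta η t l F)) (𝓝[>] 0) (𝓝 a)

/-- The integral of `δ(ℓ[φ]) f[φ]` over the modes in `V`, with the Gaussian convergence factor
`exp (-ε/2 ‖φ‖²)`, `ε → 0+`, exists and is `a`. -/
def HasModeDeltaIntegral (V : Submodule ℝ E) [FiniteDimensional ℝ V] (l : E → ℝ) (f : E → ℂ)
    (a : ℂ) : Prop :=
  ∃ A : ℝ → ℂ, (∀ ε : ℝ, 0 < ε → HasModeDelta V l (gaussReg ε f) (A ε)) ∧
    Tendsto A (𝓝[>] 0) (𝓝 a)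

/-- `f` is continuous on `V` and grows there more slowly than every Gaussian, so that its integrals
with a Gaussian convergence factor, also over hyperplanes of `V`, make sense. -/
def IsTame (V : Submodule ℝ E) (f : E → ℂ) : Prop :=
  ContinuousOn f (V : Set E) ∧
    ∀ ε : ℝ, 0 < ε → ∃ C : ℝ, ∀ φ ∈ V, ‖f φ‖ ≤ C * Real.exp (ε * ‖φ‖ ^ 2)

/-! ### Path integrals as limits of integrals over finitely many modes -/

/-- An increasing sequence of spaces of modes that exhausts the closed subspace `K`. -/
def IsExhaustion (K : Submodule ℝ E) (V : ℕ → Submodule ℝ E) : Prop :=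
  Monotone V ∧ (⨆ n, V n).topologicalClosure = K

/-- The path integral `∫ Dφ f[φ]`, `Dφ = ∏ₘ dφₘ / √(2π)`, computed with the mode cutoffs `V n` and
the renormalization factors `Z n`, exists and is `I`. Without renormalization, `Z = 1`. -/
def HasPathIntegralAlong (V : ℕ → Submodule ℝ E) [∀ n, FiniteDimensional ℝ (V n)] (Z : ℕ → ℂ)
    (f : E → ℂ) (I : ℂ) : Prop :=
  ∃ a : ℕ → ℂ, (∀ᶠ n in atTop, HasModeIntegral (V n) f (a n)) ∧
    Tendsto (fun n => Z n * a n) atTop (𝓝 I)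

/-- The path integral `∫ Dφ δ(ℓ[φ]) f[φ]`, computed with the mode cutoffs `V n` and the
renormalization factors `Z n`, exists and is `I`. -/
def HasDeltaPathIntegralAlong (V : ℕ → Submodule ℝ E) [∀ n, FiniteDimensional ℝ (V n)] (Z : ℕ → ℂ)
    (l : E → ℝ) (f : E → ℂ) (I : ℂ) : Prop :=
  ∃ a : ℕ → ℂ, (∀ᶠ n in atTop, HasModeDeltaIntegral (V n) l f (a n)) ∧
    Tendsto (fun n => Z n * a n) atTop (𝓝 I)

/-- The path integral `∫_K Dφ f[φ]` over the closed subspace `K` exists and is `I`, whichever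
orthonormal modes of `K` are used. -/
def HasPathIntegral (K : Submodule ℝ E) (f : E → ℂ) (I : ℂ) : Prop :=
  ∀ (V : ℕ → Submodule ℝ E) [∀ n, FiniteDimensional ℝ (V n)], IsExhaustion K V →
    HasPathIntegralAlong V 1 f I

/-- The path integral `∫_K Dφ δ(ℓ[φ]) f[φ]` over the closed subspace `K` exists and is `I`,
whichever orthonormal modes of `K` are used. -/
def HasDeltaPathIntegral (K : Submodule ℝ E) (l : E → ℝ) (f : E → ℂ) (I : ℂ) : Prop :=
  ∀ (V : ℕ → Submodule ℝ E) [∀ n, FiniteDimensional ℝ (V n)], IsExhaustion K V →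
    HasDeltaPathIntegralAlong V 1 l f I

end Modes

/-- The equation `x · A = y · B` between two integrals `A`, `B`, given by the predicates `P`, `Q`
("exists and has the value ..."): `A` exists if and only if `B` exists, and then it holds. -/
def IntegralsEq (x : ℝ) (P : ℂ → Prop) (y : ℝ) (Q : ℂ → Prop) : Prop :=
  ((∃ A, P A) ↔ ∃ B, Q B) ∧ ∀ A B, P A → Q B → (x : ℂ) * A = (y : ℂ) * B

/-- The space `L²_{⊥k}(S¹)` of the functions `φ` with `∮ k φ = 0`. -/
abbrev perp {T : ℝ} [Fact (0 < T)] (k : L2Circle T) : Submodule ℝ (L2Circle T) :=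
  (ℝ ∙ k)ᗮ

/-- The functional `φ ↦ γ ∮ k φ`. -/
def gaugeFun {T : ℝ} [Fact (0 < T)] (γ : ℝ) (k φ : L2Circle T) : ℝ :=
  γ * ∫ τ, k τ * φ τ

end

/-! ### Orthonormal coordinates adapted to a hyperplane of a finite-dimensional space -/

section HyperplaneSplitting

variable {E : Type*} [NormedAddCommGroup E] [InnerProductSpace ℝ E]

/-! Put `w = γ k`. On a finite-dimensional `V` the functional `⟪w, ·⟫` sees only the projection `p`
of `w` to `V`: it equals `‖p‖ ⟪u, ·⟫` with `u = p / ‖p‖`. A rotation makes `u` a coordinate axis, so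
Lebesgue measure splits as `ds dy` with `y` in `V ∩ w^⊥`, and `δ(‖p‖ s) = ‖p‖⁻¹ δ(s)`. The delta
function uses up one variable, whose factor `1/√(2π)` survives. Hence `√(2π) ‖p‖` times the delta
integral over `V` is the integral over `V ∩ w^⊥`, exactly and for each `ε`
(`IsTame.hasModeDelta_gaussReg`).

Along an exhaustion the projections of `w` converge to `w`, so the constants tend to `√(2π) ‖w‖ ≠
0`, and either limit exists with the other, whatever `Z` is (`hasDeltaPathIntegralAlong_iff`). For
intrinsic integrals, sections of exhaustions of the whole space are exhaustions of `w^⊥`, and all of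
these arise so, from `W n + ℝ w`. -/

theorem modeSum_eq_repr_symm (V : Submodule ℝ E) [FiniteDimensional ℝ V]
    (c : EuclideanSpace ℝ (Fin (Module.finrank ℝ V))) :
    modeSum V c = ((stdOrthonormalBasis ℝ V).repr.symm c : V) := by
  rw [modeSum, OrthonormalBasis.sum_repr_symm]

theorem modeSum_mem (V : Submodule ℝ E) [FiniteDimensional ℝ V]
    (c : EuclideanSpace ℝ (Fin (Module.finrank ℝ V))) : modeSum V c ∈ V :=
  Submodule.coe_mem _

theorem norm_modeSum (V : Submodule ℝ E) [FiniteDimensional ℝ V]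
    (c : EuclideanSpace ℝ (Fin (Module.finrank ℝ V))) : ‖modeSum V c‖ = ‖c‖ := by
  rw [modeSum_eq_repr_symm, ← Submodule.coe_norm, LinearIsometryEquiv.norm_map]

theorem continuous_modeSum (V : Submodule ℝ E) [FiniteDimensional ℝ V] :
    Continuous (modeSum V) := by
  have : modeSum V = fun c => ((stdOrthonormalBasis ℝ V).repr.symm c : E) :=
    funext (modeSum_eq_repr_symm V)
  rw [this]
  fun_prop

/-- If `w` acts on `V` as `c` times the unit vector `u ∈ V`, then `V ∩ w^⊥` is the orthogonal
complement of `u` in `V`. -/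
theorem mem_inf_orthogonal_iff {V : Submodule ℝ E} {w u : E} {c : ℝ} (hc : 0 < c)
    (hw : ∀ v ∈ V, inner ℝ w v = c * inner ℝ u v) {v : E} :
    v ∈ V ⊓ (ℝ ∙ w)ᗮ ↔ v ∈ V ∧ inner ℝ u v = 0 := by
  rw [Submodule.mem_inf, Submodule.mem_orthogonal_singleton_iff_inner_right]
  refine and_congr_right fun hv => ?_
  rw [hw v hv, mul_eq_zero, or_iff_right hc.ne']

theorem finrank_inf_orthogonal_add_one {V : Submodule ℝ E} [FiniteDimensional ℝ V] {w u : E}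
    {c : ℝ} (hc : 0 < c) (huV : u ∈ V) (hu : ‖u‖ = 1)
    (hw : ∀ v ∈ V, inner ℝ w v = c * inner ℝ u v) :
    Module.finrank ℝ ↥(V ⊓ (ℝ ∙ w)ᗮ) + 1 = Module.finrank ℝ V := by
  have hW : V ⊓ (ℝ ∙ w)ᗮ = (ℝ ∙ u)ᗮ ⊓ V := by
    ext v
    rw [mem_inf_orthogonal_iff hc hw, Submodule.mem_inf,
      Submodule.mem_orthogonal_singleton_iff_inner_right, and_comm]
  have hu0 : u ≠ 0 := fun h => by simp [h] at hu
  rw [hW, ← Submodule.finrank_add_inf_finrank_orthogonal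
    ((Submodule.span_singleton_le_iff_mem u V).2 huV), finrank_span_singleton hu0, add_comm]

/-- Orthonormal coordinates of `V` adapted to a unit vector `u ∈ V` and to the hyperplane of `V`
orthogonal to `u`. -/
theorem exists_measurePreserving_modeSum_eq {V : Submodule ℝ E} [FiniteDimensional ℝ V] {w u : E}
    {c : ℝ} (hc : 0 < c) (huV : u ∈ V) (hu : ‖u‖ = 1)
    (hw : ∀ v ∈ V, inner ℝ w v = c * inner ℝ u v) :
    ∃ Φ : ℝ × EuclideanSpace ℝ (Fin (Module.finrank ℝ ↥(V ⊓ (ℝ ∙ w)ᗮ))) →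
        EuclideanSpace ℝ (Fin (Module.finrank ℝ V)),
      MeasurePreserving Φ ∧ MeasurableEmbedding Φ ∧
        ∀ s y, modeSum V (Φ (s, y)) = s • u + modeSum (V ⊓ (ℝ ∙ w)ᗮ) y := by
  set W := V ⊓ (ℝ ∙ w)ᗮ with hWdef
  set n := Module.finrank ℝ W
  -- The map `(s, y) ↦ s u + ∑ yᵢ bᵢ` is isometric for the `ℓ²` product norm because `u ⊥ W`, and
  -- onto by dimension.
  let L : WithLp 2 (ℝ × EuclideanSpace ℝ (Fin n)) →ₗ[ℝ] V :=
    { toFun := fun x => x.fst • ⟨u, huV⟩ +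
        Submodule.inclusion (inf_le_left : W ≤ V) ((stdOrthonormalBasis ℝ W).repr.symm x.snd)
      map_add' := fun x y => by
        simp only [WithLp.add_fst, WithLp.add_snd, map_add, add_smul]; abel
      map_smul' := fun a x => by
        simp only [WithLp.smul_fst, WithLp.smul_snd, map_smul, smul_add, smul_smul, smul_eq_mul,
          RingHom.id_apply] }
  have hL : ∀ x, (L x : E) = x.fst • u + modeSum W x.snd := fun x => by
    rw [modeSum_eq_repr_symm]; rfl
  have hnorm : ∀ x, ‖L x‖ = ‖x‖ := fun x => by
    have h0 : inner ℝ (x.fst • u) (modeSum W x.snd) = 0 := by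
      rw [inner_smul_left, ((mem_inf_orthogonal_iff hc hw).1 (modeSum_mem W x.snd)).2, mul_zero]
    rw [Submodule.coe_norm, hL, ← sq_eq_sq₀ (norm_nonneg _) (norm_nonneg _),
      WithLp.prod_norm_sq_eq_of_L2, sq,
      norm_add_sq_eq_norm_sq_add_norm_sq_of_inner_eq_zero _ _ h0, norm_modeSum, norm_smul, hu,
      mul_one, sq, sq]
  let Li : WithLp 2 (ℝ × EuclideanSpace ℝ (Fin n)) →ₗᵢ[ℝ] V := ⟨L, hnorm⟩
  have hfin : Module.finrank ℝ (WithLp 2 (ℝ × EuclideanSpace ℝ (Fin n))) =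
      Module.finrank ℝ V := by
    rw [← finrank_inf_orthogonal_add_one hc huV hu hw,
      LinearEquiv.finrank_eq (WithLp.linearEquiv 2 ℝ _), Module.finrank_prod,
      Module.finrank_self, finrank_euclideanSpace_fin, add_comm]
  let e := (Li.toLinearIsometryEquiv hfin).trans (stdOrthonormalBasis ℝ V).repr
  refine ⟨fun x => e (WithLp.toLp 2 x),
    (e.measurePreserving).comp (WithLp.volume_preserving_toLp _ _),
    e.toMeasurableEquiv.measurableEmbedding.comp (MeasurableEquiv.toLp 2 _).measurableEmbedding,
    fun s y => ?_⟩
  rw [modeSum_eq_repr_symm]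
  have he : (stdOrthonormalBasis ℝ V).repr.symm (e (WithLp.toLp 2 (s, y))) =
      L (WithLp.toLp 2 (s, y)) := by
    simp [e, Li]
  rw [he, hL]
  rfl

end HyperplaneSplitting

/-! ### Nascent delta functions on a product `ℝ × F` -/

section DeltaFunction

theorem exists_isDeltaProfile : ∃ η : ℝ → ℝ, IsDeltaProfile η := by
  let b : ContDiffBump (0 : ℝ) := ⟨1, 2, one_pos, one_lt_two⟩
  exact ⟨b.normed volume, b.continuous_normed, b.hasCompactSupport_normed, b.integral_normed⟩

variable {F : Type*} [NormedAddCommGroup F] [InnerProductSpace ℝ F] [FiniteDimensional ℝ F]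
  [MeasurableSpace F] [BorelSpace F]

theorem integrable_exp_neg_mul_norm_sq {b : ℝ} (hb : 0 < b) :
    Integrable fun v : F => Real.exp (-b * ‖v‖ ^ 2) := by
  have h := (GaussianFourier.integrable_cexp_neg_mul_sq_norm_add (b := (b : ℂ)) (V := F)
    (by simpa using hb) 0 0).norm
  refine h.congr (ae_of_all _ fun v => ?_)
  simp only [zero_mul, add_zero, Complex.norm_exp]
  norm_cast

variable {g : ℝ × F → ℂ} {η : ℝ → ℝ} {c C b : ℝ}

/-- The bound on `g` is uniform in `s`: decay in `s` comes from the compact support of `η`, decay in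
`y` from the Gaussian. -/
theorem integrable_smeared (hg : Continuous g) (hC : ∀ s y, ‖g (s, y)‖ ≤ C * Real.exp (-b * ‖y‖ ^ 2))
    (hb : 0 < b) (hη : IsDeltaProfile η) (hc : 0 < c) {t : ℝ} (ht : 0 < t) :
    Integrable fun x : ℝ × F => ((t⁻¹ * η (c * x.1 / t) : ℝ) : ℂ) * g x := by
  have hηi : Integrable fun s => t⁻¹ * η (c * s / t) := by
    have := (((hη.1.integrable_of_hasCompactSupport hη.2.1).comp_mul_left'
      (div_pos hc ht).ne').const_mul t⁻¹)
    refine this.congr (ae_of_all _ fun s => ?_)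
    simp only [mul_div_right_comm]
  have hmaj := hηi.norm.mul_prod ((integrable_exp_neg_mul_norm_sq (F := F) hb).const_mul C)
  have hηc := hη.1
  refine Integrable.mono' hmaj (by fun_prop) (ae_of_all _ fun x => ?_)
  rw [norm_mul, Complex.norm_real]
  exact mul_le_mul_of_nonneg_left (hC x.1 x.2) (norm_nonneg _)

/-- Nascent delta functions of `c s` converge to `c⁻¹ δ(s)`. -/
theorem tendsto_integral_smeared (hg : Continuous g)
    (hC : ∀ s y, ‖g (s, y)‖ ≤ C * Real.exp (-b * ‖y‖ ^ 2))
    (hb : 0 < b) (hη : IsDeltaProfile η) (hc : 0 < c) :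
    Tendsto (fun t : ℝ => ∫ x : ℝ × F, ((t⁻¹ * η (c * x.1 / t) : ℝ) : ℂ) * g x) (𝓝[>] 0)
      (𝓝 ((c⁻¹ : ℝ) * ∫ y, g (0, y))) := by
  have hηc := hη.1
  have hηi : Integrable fun s => η (c * s) :=
    (hη.1.integrable_of_hasCompactSupport hη.2.1).comp_mul_left' hc.ne'
  have hmaj := hηi.norm.mul_prod ((integrable_exp_neg_mul_norm_sq (F := F) hb).const_mul C)
  -- Substituting `s → t s` moves `t` from the profile into `g`, so that one majorant serves all
  -- `t`.
  have key : ∀ t : ℝ, 0 < t →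
      ∫ x : ℝ × F, ((t⁻¹ * η (c * x.1 / t) : ℝ) : ℂ) * g x =
        ∫ x : ℝ × F, ((η (c * x.1) : ℝ) : ℂ) * g (t * x.1, x.2) := by
    intro t ht
    have hint : Integrable fun x : ℝ × F => ((η (c * x.1) : ℝ) : ℂ) * g (t * x.1, x.2) := by
      refine Integrable.mono' hmaj (by fun_prop) (ae_of_all _ fun x => ?_)
      rw [norm_mul, Complex.norm_real]
      exact mul_le_mul_of_nonneg_left (hC _ _) (norm_nonneg _)
    rw [Measure.volume_eq_prod, integral_prod_symm _ (integrable_smeared hg hC hb hη hc ht),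
      integral_prod_symm _ hint]
    refine integral_congr_ae (ae_of_all _ fun y => ?_)
    have h := Measure.integral_comp_mul_left
      (fun s : ℝ => ((t⁻¹ * η (c * s / t) : ℝ) : ℂ) * g (s, y)) t
    rw [abs_of_pos (inv_pos.2 ht)] at h
    have h2 : (fun s : ℝ => ((t⁻¹ * η (c * (t * s) / t) : ℝ) : ℂ) * g (t * s, y)) =
        fun s => t⁻¹ • (((η (c * s) : ℝ) : ℂ) * g (t * s, y)) := by
      funext s
      rw [show c * (t * s) / t = c * s by field_simp, Complex.real_smul]
      push_cast
      ring
    rw [h2, integral_smul] at h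
    exact (smul_right_injective ℂ (inv_pos.2 ht).ne' h).symm
  have hlim : Tendsto (fun t : ℝ => ∫ x : ℝ × F, ((η (c * x.1) : ℝ) : ℂ) * g (t * x.1, x.2))
      (𝓝[>] 0) (𝓝 (∫ x : ℝ × F, ((η (c * x.1) : ℝ) : ℂ) * g (0, x.2))) := by
    refine tendsto_integral_filter_of_dominated_convergence _ ?_ ?_ hmaj ?_
    · exact Eventually.of_forall fun t => by fun_prop
    · refine Eventually.of_forall fun t => ae_of_all _ fun x => ?_
      rw [norm_mul, Complex.norm_real]
      exact mul_le_mul_of_nonneg_left (hC _ _) (norm_nonneg _)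
    · refine ae_of_all _ fun x => ?_
      have : Continuous fun t : ℝ => ((η (c * x.1) : ℝ) : ℂ) * g (t * x.1, x.2) := by fun_prop
      simpa using (this.tendsto 0).mono_left nhdsWithin_le_nhds
  have hval : ∫ x : ℝ × F, ((η (c * x.1) : ℝ) : ℂ) * g (0, x.2) =
      (c⁻¹ : ℝ) * ∫ y, g (0, y) := by
    rw [Measure.volume_eq_prod,
      integral_prod_mul (fun s : ℝ => ((η (c * s) : ℝ) : ℂ)) (fun y => g (0, y))]
    congr 1
    rw [integral_complex_ofReal, Measure.integral_comp_mul_left, hη.2.2,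
      abs_of_pos (inv_pos.2 hc), smul_eq_mul, mul_one]
  rw [← hval]
  refine hlim.congr' ?_
  filter_upwards [self_mem_nhdsWithin] with t ht using (key t ht).symm

end DeltaFunction

/-! ### The delta integral over finitely many modes -/

section ModeIntegrals

variable {E : Type*} [NormedAddCommGroup E] [InnerProductSpace ℝ E] {V : Submodule ℝ E}
  {f : E → ℂ}

theorem IsTame.mono {W : Submodule ℝ E} (hf : IsTame V f) (hWV : W ≤ V) : IsTame W f :=
  ⟨hf.1.mono hWV, fun ε hε => (hf.2 ε hε).imp fun _ hC φ hφ => hC φ (hWV hφ)⟩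

theorem IsTame.exists_norm_gaussReg_le (hf : IsTame V f) {ε : ℝ} (hε : 0 < ε) :
    ∃ C, 0 ≤ C ∧ ∀ φ ∈ V, ‖gaussReg ε f φ‖ ≤ C * Real.exp (-(ε / 4) * ‖φ‖ ^ 2) := by
  -- Half of the exponent `ε / 2` absorbs the growth of `f`; the other half remains as decay.
  obtain ⟨C, hC⟩ := hf.2 (ε / 4) (by positivity)
  refine ⟨C, ?_, fun φ hφ => ?_⟩
  · simpa using (norm_nonneg _).trans (hC 0 V.zero_mem)
  · rw [gaussReg, norm_mul, Complex.norm_real, Real.norm_of_nonneg (Real.exp_pos _).le]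
    calc ‖f φ‖ * Real.exp (-(ε / 2) * ‖φ‖ ^ 2)
        ≤ C * Real.exp (ε / 4 * ‖φ‖ ^ 2) * Real.exp (-(ε / 2) * ‖φ‖ ^ 2) := by
          gcongr
          exact hC φ hφ
      _ = C * Real.exp (-(ε / 4) * ‖φ‖ ^ 2) := by
          rw [mul_assoc, ← Real.exp_add]
          ring_nf

theorem IsTame.continuousOn_gaussReg (hf : IsTame V f) (ε : ℝ) :
    ContinuousOn (gaussReg ε f) (V : Set E) := by
  have := hf.1
  unfold gaussReg
  fun_prop

theorem IsTame.modeIntegrable_gaussReg [FiniteDimensional ℝ V] (hf : IsTame V f) {ε : ℝ}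
    (hε : 0 < ε) : ModeIntegrable V (gaussReg ε f) := by
  obtain ⟨C, -, hC⟩ := hf.exists_norm_gaussReg_le hε
  have hcont := (hf.continuousOn_gaussReg ε).comp_continuous (continuous_modeSum V) (modeSum_mem V)
  refine Integrable.mono' ((integrable_exp_neg_mul_norm_sq (by positivity : 0 < ε / 4)).const_mul C)
    hcont.aestronglyMeasurable (ae_of_all _ fun c => ?_)
  simpa only [norm_modeSum] using hC _ (modeSum_mem V c)

theorem HasModeIntegral.unique [FiniteDimensional ℝ V] {a b : ℂ} (ha : HasModeIntegral V f a)
    (hb : HasModeIntegral V f b) : a = b :=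
  tendsto_nhds_unique ha.2 hb.2

/-- The definition quantifies over all profiles, so the existence of one is needed. -/
theorem HasModeDelta.unique [FiniteDimensional ℝ V] {l : E → ℝ} {F : E → ℂ} {a b : ℂ}
    (ha : HasModeDelta V l F a) (hb : HasModeDelta V l F b) : a = b := by
  obtain ⟨η, hη⟩ := exists_isDeltaProfile
  exact tendsto_nhds_unique (ha η hη).2 (hb η hη).2

/-- Integrating out the delta function over the modes in `V` leaves the integral over the
hyperplane of `V` on which its argument vanishes. -/
theorem IsTame.hasModeDelta_gaussReg [FiniteDimensional ℝ V] (hf : IsTame V f) {w u : E} {c : ℝ}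
    (hc : 0 < c) (huV : u ∈ V) (hu : ‖u‖ = 1) (hw : ∀ v ∈ V, inner ℝ w v = c * inner ℝ u v)
    {ε : ℝ} (hε : 0 < ε) :
    HasModeDelta V (fun v => inner ℝ w v) (gaussReg ε f)
      (((√(2 * Real.pi) * c : ℝ) : ℂ)⁻¹ * modeIntegral (V ⊓ (ℝ ∙ w)ᗮ) (gaussReg ε f)) := by
  obtain ⟨Φ, hΦm, hΦe, hΦ⟩ := exists_measurePreserving_modeSum_eq hc huV hu hw
  obtain ⟨C, hC0, hC⟩ := hf.exists_norm_gaussReg_le hε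
  have hort : ∀ y, modeSum (V ⊓ (ℝ ∙ w)ᗮ) y ∈ V ∧ inner ℝ u (modeSum (V ⊓ (ℝ ∙ w)ᗮ) y) = 0 := fun y =>
    (mem_inf_orthogonal_iff hc hw).1 (modeSum_mem _ y)
  have hmem : ∀ s y, s • u + modeSum (V ⊓ (ℝ ∙ w)ᗮ) y ∈ V := fun s y =>
    V.add_mem (V.smul_mem s huV) (hort y).1
  have hlin : ∀ s y, inner ℝ w (s • u + modeSum (V ⊓ (ℝ ∙ w)ᗮ) y) = c * s := fun s y => by
    rw [hw _ (hmem s y), inner_add_right, (hort y).2, inner_smul_right,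
      real_inner_self_eq_norm_sq, hu]
    ring
  let g : ℝ × EuclideanSpace ℝ (Fin (Module.finrank ℝ ↥(V ⊓ (ℝ ∙ w)ᗮ))) → ℂ :=
    fun x => gaussReg ε f (x.1 • u + modeSum (V ⊓ (ℝ ∙ w)ᗮ) x.2)
  have hg : Continuous g := by
    refine (hf.continuousOn_gaussReg ε).comp_continuous ?_ fun x => hmem x.1 x.2
    have := continuous_modeSum (V ⊓ (ℝ ∙ w)ᗮ)
    fun_prop
  have hgC : ∀ s y, ‖g (s, y)‖ ≤ C * Real.exp (-(ε / 4) * ‖y‖ ^ 2) := fun s y => by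
    refine (hC _ (hmem s y)).trans ?_
    -- By Pythagoras, dropping the `s` part of the exponent leaves a bound uniform in `s`.
    have h : ‖s • u + modeSum (V ⊓ (ℝ ∙ w)ᗮ) y‖ ^ 2 = ‖s • u‖ ^ 2 + ‖y‖ ^ 2 := by
      rw [norm_add_sq_real, inner_smul_left, (hort y).2, norm_modeSum]
      simp
    refine mul_le_mul_of_nonneg_left (Real.exp_le_exp.2 ?_) hC0
    rw [h]
    nlinarith [sq_nonneg ‖s • u‖]
  have hcoord : ∀ (η : ℝ → ℝ) (t : ℝ),
      (fun x => smearedDelta η t (fun v => inner ℝ w v) (gaussReg ε f) (modeSum V (Φ x))) =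
        fun x => ((t⁻¹ * η (c * x.1 / t) : ℝ) : ℂ) * g x := fun η t => by
    funext ⟨s, y⟩
    simp only [smearedDelta, hΦ, hlin, g]
  intro η hη
  refine ⟨fun t ht => ?_, ?_⟩
  · rw [ModeIntegrable, ← hΦm.integrable_comp_emb hΦe]
    exact (integrable_smeared hg hgC (by positivity) hη hc ht).congr
      (ae_of_all _ fun x => (congrFun (hcoord η t) x).symm)
  · have hfin := finrank_inf_orthogonal_add_one hc huV hu hw
    have hlim := (tendsto_integral_smeared hg hgC (by positivity) hη hc).const_mul
      (((1 / √(2 * Real.pi)) ^ Module.finrank ℝ V : ℝ) : ℂ)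
    have h1 : (((1 / √(2 * Real.pi)) ^ Module.finrank ℝ V : ℝ) : ℂ) *
        ((c⁻¹ : ℝ) * ∫ y, g (0, y)) =
          ((√(2 * Real.pi) * c : ℝ) : ℂ)⁻¹ * modeIntegral (V ⊓ (ℝ ∙ w)ᗮ) (gaussReg ε f) := by
      simp only [modeIntegral, g, zero_smul, zero_add]
      -- `V` has one dimension more than the hyperplane: this is the surviving factor `1/√(2π)`.
      rw [← hfin, pow_succ]
      push_cast
      rw [one_div, mul_inv]
      ring
    rw [← h1]
    refine hlim.congr fun t => ?_
    rw [modeIntegral, ← hΦm.integral_comp hΦe, hcoord]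

/-- For each `ε` the delta integral exists by tameness and is unique, so only the two limits `ε →
0+` are compared; they differ by a nonzero constant. -/
theorem IsTame.hasModeDeltaIntegral_iff [FiniteDimensional ℝ V] (hf : IsTame V f) {w u : E}
    {c : ℝ} (hc : 0 < c) (huV : u ∈ V) (hu : ‖u‖ = 1)
    (hw : ∀ v ∈ V, inner ℝ w v = c * inner ℝ u v) {a : ℂ} :
    HasModeDeltaIntegral V (fun v => inner ℝ w v) f a ↔
      HasModeIntegral (V ⊓ (ℝ ∙ w)ᗮ) f ((√(2 * Real.pi) * c : ℝ) * a) := by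
  have hr : ((√(2 * Real.pi) * c : ℝ) : ℂ) ≠ 0 := by
    exact_mod_cast (by positivity : 0 < √(2 * Real.pi) * c).ne'
  have hδ := fun (ε : ℝ) (hε : 0 < ε) => hf.hasModeDelta_gaussReg hc huV hu hw hε
  constructor
  · rintro ⟨A, hA, hlim⟩
    refine ⟨fun ε hε => (hf.mono inf_le_left).modeIntegrable_gaussReg hε,
      (hlim.const_mul _).congr' ?_⟩
    filter_upwards [self_mem_nhdsWithin] with ε hε
    rw [(hA ε hε).unique (hδ ε hε), mul_inv_cancel_left₀ hr]
  · rintro ⟨-, hlim⟩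
    refine ⟨_, hδ, ?_⟩
    simpa only [inv_mul_cancel_left₀ hr] using hlim.const_mul (((√(2 * Real.pi) * c : ℝ) : ℂ)⁻¹)

theorem IsTame.hasModeDeltaIntegral_iff_starProjection [FiniteDimensional ℝ V] (hf : IsTame V f)
    {w : E} (hw : V.starProjection w ≠ 0) {a : ℂ} :
    HasModeDeltaIntegral V (fun v => inner ℝ w v) f a ↔
      HasModeIntegral (V ⊓ (ℝ ∙ w)ᗮ) f ((√(2 * Real.pi) * ‖V.starProjection w‖ : ℝ) * a) := by
  refine hf.hasModeDeltaIntegral_iff (norm_pos_iff.2 hw)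
    (u := ‖V.starProjection w‖⁻¹ • V.starProjection w)
    (V.smul_mem _ (V.starProjection_apply_mem w)) 
    (by rw [norm_smul, norm_inv, norm_norm, inv_mul_cancel₀ (norm_ne_zero_iff.2 hw)]) fun v hv => ?_
  rw [inner_smul_left, conj_trivial, mul_inv_cancel_left₀ (norm_ne_zero_iff.2 hw),
    V.inner_starProjection_left_eq_right, V.starProjection_eq_self_iff.2 hv]

end ModeIntegrals

/-! ### Passage to the limit along exhaustions -/

section PathIntegrals

variable {E : Type*} [NormedAddCommGroup E] [InnerProductSpace ℝ E] {f : E → ℂ} {w : E}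

theorem HasPathIntegralAlong.unique {V : ℕ → Submodule ℝ E} [∀ n, FiniteDimensional ℝ (V n)]
    {Z : ℕ → ℂ} {I J : ℂ} (hI : HasPathIntegralAlong V Z f I) (hJ : HasPathIntegralAlong V Z f J) :
    I = J := by
  obtain ⟨a, ha, hI⟩ := hI
  obtain ⟨b, hb, hJ⟩ := hJ
  refine tendsto_nhds_unique hI (hJ.congr' ?_)
  filter_upwards [ha, hb] with n h1 h2
  rw [h1.unique h2]

theorem IsExhaustion.tendsto_norm_starProjection {V : ℕ → Submodule ℝ E}
    [∀ n, FiniteDimensional ℝ (V n)] (hV : IsExhaustion ⊤ V) (w : E) :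
    Tendsto (fun n => ‖(V n).starProjection w‖) atTop (𝓝 ‖w‖) :=
  (Submodule.starProjection_tendsto_self V hV.1 w hV.2.ge).norm

/-- The finite-dimensional identity needs a nonzero projection of `w`, which holds for all large
`n`. The constants converge to a nonzero limit, so multiplying or dividing by them preserves
convergence. -/
theorem hasDeltaPathIntegralAlong_iff {V : ℕ → Submodule ℝ E} [∀ n, FiniteDimensional ℝ (V n)]
    (hV : IsExhaustion ⊤ V) (hf : ∀ n, IsTame (V n) f) (hw : w ≠ 0) (Z : ℕ → ℂ) {A : ℂ} :
    HasDeltaPathIntegralAlong V Z (fun v => inner ℝ w v) f A ↔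
      HasPathIntegralAlong (fun n => V n ⊓ (ℝ ∙ w)ᗮ) Z f ((√(2 * Real.pi) * ‖w‖ : ℝ) * A) := by
  have hnorm := hV.tendsto_norm_starProjection w
  have hne : ∀ᶠ n in atTop, (V n).starProjection w ≠ 0 := by
    filter_upwards [hnorm.eventually_ne (norm_ne_zero_iff.2 hw)] with n hn using
      norm_ne_zero_iff.1 hn
  have hr : Tendsto (fun n => ((√(2 * Real.pi) * ‖(V n).starProjection w‖ : ℝ) : ℂ)) atTop
      (𝓝 ((√(2 * Real.pi) * ‖w‖ : ℝ) : ℂ)) :=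
    (Complex.continuous_ofReal.tendsto _).comp (hnorm.const_mul _)
  have hr0 : ∀ v : E, v ≠ 0 → ((√(2 * Real.pi) * ‖v‖ : ℝ) : ℂ) ≠ 0 := fun v hv => by
    have := norm_pos_iff.2 hv
    exact_mod_cast (by positivity : 0 < √(2 * Real.pi) * ‖v‖).ne'
  constructor
  · rintro ⟨a, ha, hlim⟩
    refine ⟨fun n => ((√(2 * Real.pi) * ‖(V n).starProjection w‖ : ℝ) : ℂ) * a n, ?_, ?_⟩
    · filter_upwards [ha, hne] with n han hn
      exact ((hf n).hasModeDeltaIntegral_iff_starProjection hn).1 han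
    · simpa only [mul_left_comm] using hr.mul hlim
  · rintro ⟨b, hb, hlim⟩
    refine ⟨fun n => ((√(2 * Real.pi) * ‖(V n).starProjection w‖ : ℝ) : ℂ)⁻¹ * b n, ?_, ?_⟩
    · filter_upwards [hb, hne] with n hbn hn
      rw [(hf n).hasModeDeltaIntegral_iff_starProjection hn, mul_inv_cancel_left₀ (hr0 _ hn)]
      exact hbn
    · simpa only [mul_left_comm, inv_mul_cancel_left₀ (hr0 w hw)] using (hr.inv₀ (hr0 w hw)).mul hlim

/-- The hyperplane sections of an exhaustion of the whole space exhaust the hyperplane. -/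
theorem IsExhaustion.inf_orthogonal {V : ℕ → Submodule ℝ E} [∀ n, FiniteDimensional ℝ (V n)]
    (hV : IsExhaustion ⊤ V) (hw : w ≠ 0) :
    IsExhaustion (ℝ ∙ w)ᗮ fun n => V n ⊓ (ℝ ∙ w)ᗮ := by
  have hmono : Monotone fun n => V n ⊓ (ℝ ∙ w)ᗮ := fun m n h => inf_le_inf_right _ (hV.1 h)
  refine ⟨hmono, le_antisymm ?_ fun φ hφ => ?_⟩
  · exact Submodule.topologicalClosure_minimal _ (iSup_le fun n => inf_le_right)
      (Submodule.isClosed_orthogonal _)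
  have hφ0 := Submodule.mem_orthogonal_singleton_iff_inner_right.1 hφ
  obtain ⟨N, hN⟩ := ((hV.tendsto_norm_starProjection w).eventually_ne
    (norm_ne_zero_iff.2 hw)).exists
  set p := (V N).starProjection w
  have hp : p ∈ V N := (V N).starProjection_apply_mem w
  have hwp : inner ℝ w p ≠ 0 := by
    have h : inner ℝ w p = inner ℝ p p := by
      rw [(V N).inner_starProjection_left_eq_right, (V N).starProjection_eq_self_iff.2 hp]
    rw [h, real_inner_self_eq_norm_sq]
    positivity
  have hmem : φ ∈ closure ((⨆ n, V n : Submodule ℝ E) : Set E) := by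
    rw [← Submodule.topologicalClosure_coe, hV.2]
    trivial
  -- Since `w` need not lie in any `V n`, the orthogonal projection to `w^⊥` could leave these
  -- spaces. The projection along `p ∈ V N` keeps `V n` inside `V (max n N)`, and it fixes `φ`.
  let q : E → E := fun x => x - (inner ℝ w x / inner ℝ w p) • p
  have hq : Continuous q := by fun_prop
  have hqφ : q φ = φ := by simp [q, hφ0]
  rw [← hqφ, ← SetLike.mem_coe, Submodule.topologicalClosure_coe]
  refine map_mem_closure hq hmem fun x hx => ?_
  obtain ⟨n, hn⟩ := (Submodule.mem_iSup_of_directed V hV.1.directed_le).1 hx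
  refine Submodule.mem_iSup_of_mem (max n N) (Submodule.mem_inf.2 ⟨?_, ?_⟩)
  · exact Submodule.sub_mem _ (hV.1 (le_max_left n N) hn)
      (Submodule.smul_mem _ _ (hV.1 (le_max_right n N) hp))
  · rw [Submodule.mem_orthogonal_singleton_iff_inner_right, inner_sub_right, inner_smul_right,
      div_mul_cancel₀ _ hwp, sub_self]

/-- An exhaustion of a hyperplane, enlarged by the normal, exhausts the whole space. -/
theorem IsExhaustion.sup_span_singleton {W : ℕ → Submodule ℝ E}
    (hW : IsExhaustion (ℝ ∙ w)ᗮ W) : IsExhaustion ⊤ fun n => W n ⊔ ℝ ∙ w := by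
  refine ⟨fun m n h => sup_le_sup_right (hW.1 h) _, top_le_iff.1 ?_⟩
  rw [← Submodule.sup_orthogonal_of_hasOrthogonalProjection (K := ℝ ∙ w)]
  refine sup_le ?_ ?_
  · exact (le_sup_right.trans (le_iSup (fun n => W n ⊔ ℝ ∙ w) 0)).trans
      (Submodule.le_topologicalClosure _)
  · nth_rw 1 [← hW.2]
    exact Submodule.topologicalClosure_mono (iSup_mono fun n => le_sup_left)

/-- This is the modular law; it recovers a given exhaustion of the hyperplane as the sections of its
enlargement. -/
theorem sup_span_singleton_inf_orthogonal {W : Submodule ℝ E} (hW : W ≤ (ℝ ∙ w)ᗮ) :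
    (W ⊔ ℝ ∙ w) ⊓ (ℝ ∙ w)ᗮ = W := by
  rw [sup_inf_assoc_of_le _ hW, Submodule.inf_orthogonal_eq_bot, sup_bot_eq]

theorem hasDeltaPathIntegral_iff
    (hf : ∀ (V : Submodule ℝ E) [FiniteDimensional ℝ V], IsTame V f) (hw : w ≠ 0) {A : ℂ} :
    HasDeltaPathIntegral ⊤ (fun v => inner ℝ w v) f A ↔
      HasPathIntegral (ℝ ∙ w)ᗮ f ((√(2 * Real.pi) * ‖w‖ : ℝ) * A) := by
  constructor
  · intro h W _ hW
    have hWle : ∀ n, W n ≤ (ℝ ∙ w)ᗮ := fun n =>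
      (le_iSup W n).trans ((Submodule.le_topologicalClosure _).trans hW.2.le)
    have hV := hW.sup_span_singleton
    have h2 := (hasDeltaPathIntegralAlong_iff hV (fun n => hf _) hw 1).1 (h _ hV)
    simp only [sup_span_singleton_inf_orthogonal (hWle _)] at h2
    exact h2
  · intro h V _ hV
    exact (hasDeltaPathIntegralAlong_iff hV (fun n => hf _) hw 1).2 (h _ (hV.inf_orthogonal hw))

/-- Uniqueness is needed only for `Q`: a value of `P` is transported to one of `Q` by a nonzero
factor. -/
theorem integralsEq_of_iff {P Q : ℂ → Prop} {x r : ℝ} (hx : x ≠ 0) (hr : r ≠ 0)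
    (h : ∀ A, P A ↔ Q ((x * r : ℝ) * A)) (hQ : ∀ A B, Q A → Q B → A = B) :
    IntegralsEq x P (1 / r) Q := by
  have hx' : (x : ℂ) ≠ 0 := by exact_mod_cast hx
  have hr' : (r : ℂ) ≠ 0 := by exact_mod_cast hr
  refine ⟨⟨fun ⟨A, hA⟩ => ⟨_, (h A).1 hA⟩, fun ⟨B, hB⟩ => ⟨((x * r : ℝ) : ℂ)⁻¹ * B, ?_⟩⟩,
    fun A B hA hB => ?_⟩
  · rw [h, mul_inv_cancel_left₀ (by exact_mod_cast mul_ne_zero hx hr)]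
    exact hB
  · rw [hQ B _ hB ((h A).1 hA)]
    push_cast
    field_simp

end PathIntegrals

/-! ### Trigonometric modes and the gauge functional on the circle -/

section Circle

variable {T : ℝ} [Fact (0 < T)]

theorem trigFun_apply_re {m : ℤ} (hm : 0 < m) (τ : AddCircle T) :
    trigFun T m τ = √(2 / T) * (fourier m τ).re := by
  simp [trigFun, hm.ne', hm.not_gt]

theorem trigFun_apply_im {m : ℤ} (hm : 0 < m) (τ : AddCircle T) :
    trigFun T (-m) τ = √(2 / T) * (fourier m τ).im := by
  simp [trigFun, hm]

theorem trigFun_zero_apply (τ : AddCircle T) : trigFun T 0 τ = √(1 / T) := by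
  simp [trigFun]

/-- The real and imaginary parts of the exponentials are trigonometric polynomials. -/
theorem re_im_fourier_mem_span (n : ℤ) :
    ∃ a ∈ Submodule.span ℝ (Set.range (trigFun T)), ∃ b ∈ Submodule.span ℝ (Set.range (trigFun T)),
      ∀ τ, a τ = (fourier n τ).re ∧ b τ = (fourier n τ).im := by
  have hT : 0 < T := Fact.out
  have hmem : ∀ (r : ℝ) m, r • trigFun T m ∈ Submodule.span ℝ (Set.range (trigFun T)) :=
    fun r m => Submodule.smul_mem _ r (Submodule.subset_span ⟨m, rfl⟩)
  have h2 : √(2 / T) ≠ 0 := by positivity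
  have h1 : √(1 / T) ≠ 0 := by positivity
  rcases lt_trichotomy n 0 with hn | rfl | hn
  -- For `n < 0` the exponential is the conjugate of the one with index `-n`, hence the sign of the
  -- sine coefficient.
  · refine ⟨_, hmem (√(2 / T))⁻¹ (-n), _, hmem (-(√(2 / T))⁻¹) n, fun τ => ?_⟩
    have hn' : 0 < -n := neg_pos.2 hn
    have h := trigFun_apply_im hn' τ
    rw [neg_neg] at h
    rw [ContinuousMap.smul_apply, ContinuousMap.smul_apply, h, trigFun_apply_re hn', fourier_neg]
    simp only [smul_eq_mul, Complex.conj_re, Complex.conj_im, neg_mul, mul_neg, neg_neg,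
      inv_mul_cancel_left₀ h2, and_self]
  · refine ⟨_, hmem (√(1 / T))⁻¹ 0, 0, Submodule.zero_mem _, fun τ => ?_⟩
    rw [ContinuousMap.smul_apply, trigFun_zero_apply, fourier_zero, smul_eq_mul, inv_mul_cancel₀ h1]
    simp
  · refine ⟨_, hmem (√(2 / T))⁻¹ n, _, hmem (√(2 / T))⁻¹ (-n), fun τ => ?_⟩
    rw [ContinuousMap.smul_apply, ContinuousMap.smul_apply, trigFun_apply_re hn,
      trigFun_apply_im hn]
    simp only [smul_eq_mul, inv_mul_cancel_left₀ h2, and_self]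

/-- The real trigonometric polynomials are dense in the continuous functions. -/
theorem span_trigFun_closure_eq_top :
    (Submodule.span ℝ (Set.range (trigFun T))).topologicalClosure = ⊤ := by
  refine top_le_iff.1 fun g _ => ?_
  -- Taking real parts is continuous and sends complex trigonometric polynomials to real ones, so
  -- density descends from the complex case.
  let re : C(AddCircle T, ℂ) → C(AddCircle T, ℝ) :=
    fun h => ContinuousMap.comp ⟨Complex.re, Complex.continuous_re⟩ h
  have hre : Continuous re := ContinuousMap.continuous_postcomp _
  let G : C(AddCircle T, ℂ) := ContinuousMap.comp ⟨Complex.ofReal, Complex.continuous_ofReal⟩ g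
  have hG : G ∈ closure ((Submodule.span ℂ (Set.range (@fourier T)) :
      Submodule ℂ C(AddCircle T, ℂ)) : Set C(AddCircle T, ℂ)) := by
    rw [← Submodule.topologicalClosure_coe, span_fourier_closure_eq_top]
    trivial
  have hg : re G = g := by
    ext τ
    simp [re, G]
  rw [← hg, ← SetLike.mem_coe, Submodule.topologicalClosure_coe]
  refine map_mem_closure hre hG fun h hh => ?_
  -- Complex scalars mix real and imaginary parts, so the induction has to carry both.
  have key : ∃ a ∈ Submodule.span ℝ (Set.range (trigFun T)),
      ∃ b ∈ Submodule.span ℝ (Set.range (trigFun T)), ∀ τ, a τ = (h τ).re ∧ b τ = (h τ).im := by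
    induction hh using Submodule.span_induction with
    | mem h hh =>
      obtain ⟨n, rfl⟩ := hh
      exact re_im_fourier_mem_span n
    | zero => exact ⟨0, Submodule.zero_mem _, 0, Submodule.zero_mem _, fun τ => by simp⟩
    | add x y _ _ hx hy =>
      obtain ⟨a, ha, b, hb, h1⟩ := hx
      obtain ⟨a', ha', b', hb', h2⟩ := hy
      exact ⟨a + a', Submodule.add_mem _ ha ha', b + b', Submodule.add_mem _ hb hb',
        fun τ => by simp [(h1 τ).1, (h1 τ).2, (h2 τ).1, (h2 τ).2]⟩
    | smul z x _ hx =>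
      obtain ⟨a, ha, b, hb, h1⟩ := hx
      exact ⟨z.re • a - z.im • b,
        Submodule.sub_mem _ (Submodule.smul_mem _ _ ha) (Submodule.smul_mem _ _ hb),
        z.re • b + z.im • a,
        Submodule.add_mem _ (Submodule.smul_mem _ _ hb) (Submodule.smul_mem _ _ ha),
        fun τ => by simp [(h1 τ).1, (h1 τ).2]⟩
  obtain ⟨a, ha, b, _, h1⟩ := key
  have : re h = a := by
    ext τ
    simp [re, (h1 τ).1]
  rw [this]
  exact ha

/-- Trigonometric polynomials are uniformly dense in the continuous functions, which are dense in
`L²`. -/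
theorem isExhaustion_trigCutoff (T : ℝ) [Fact (0 < T)] : IsExhaustion ⊤ (trigCutoff T) := by
  refine ⟨fun m n h => Submodule.span_mono (Set.image_mono (Set.Icc_subset_Icc (by lia) (by lia))),
    top_le_iff.1 fun φ _ => ?_⟩
  let J : C(AddCircle T, ℝ) →L[ℝ] L2Circle T :=
    ContinuousMap.toLp (E := ℝ) 2 (volume : Measure (AddCircle T)) ℝ
  have hJ : ∀ g, J g ∈ (⨆ n, trigCutoff T n).topologicalClosure := by
    intro g
    have hg : g ∈ closure ((Submodule.span ℝ (Set.range (trigFun T)) :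
        Submodule ℝ C(AddCircle T, ℝ)) : Set C(AddCircle T, ℝ)) := by
      rw [← Submodule.topologicalClosure_coe, span_trigFun_closure_eq_top]
      trivial
    rw [← SetLike.mem_coe, Submodule.topologicalClosure_coe]
    refine map_mem_closure J.continuous hg fun h hh => ?_
    have hle : Submodule.span ℝ (Set.range (trigFun T)) ≤
        (⨆ n, trigCutoff T n).comap (J : C(AddCircle T, ℝ) →ₗ[ℝ] L2Circle T) := by
      rw [Submodule.span_le]
      rintro _ ⟨m, rfl⟩
      exact Submodule.mem_iSup_of_mem m.natAbs
        (Submodule.subset_span ⟨m, ⟨by lia, by lia⟩, rfl⟩)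
    exact hle hh
  have hdense : DenseRange J := ContinuousMap.toLp_denseRange ℝ _ ℝ (by simp)
  exact hdense.induction_on φ (Submodule.isClosed_topologicalClosure _) hJ

theorem gaugeFun_eq_inner (γ : ℝ) (k : L2Circle T) :
    gaugeFun γ k = fun φ => inner ℝ (γ • k) φ := by
  funext φ
  rw [gaugeFun, inner_smul_left, conj_trivial, L2.inner_def]
  simp only [RCLike.inner_apply, conj_trivial, mul_comm]

theorem sqrt_sq_mul_integral_sq (γ : ℝ) (k : L2Circle T) :
    √(γ ^ 2 * ∫ τ, k τ ^ 2) = ‖γ • k‖ := by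
  have h : ∫ τ, k τ ^ 2 = ‖k‖ ^ 2 := by
    rw [← real_inner_self_eq_norm_sq, L2.inner_def]
    simp only [RCLike.inner_apply, conj_trivial, sq]
  rw [h, ← mul_pow, ← sq_abs, abs_mul, abs_norm, Real.sqrt_sq (by positivity), norm_smul,
    Real.norm_eq_abs]

theorem perp_eq_orthogonal_smul {γ : ℝ} (hγ : γ ≠ 0) (k : L2Circle T) :
    perp k = (ℝ ∙ (γ • k))ᗮ := by
  rw [perp, Submodule.span_singleton_smul_eq (IsUnit.mk0 γ hγ)]

end Circle

theorem theorem3 (T : ℝ) [Fact (0 < T)] (γ : ℝ) (hγ : γ ≠ 0) (k : L2Circle T) (hk : k ≠ 0)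
    (f : L2Circle T → ℂ) :
    -- mode by mode in the trigonometric basis
    ((∀ N, IsTame (trigCutoff T N) f) → ∀ Z : ℕ → ℂ,
      IntegralsEq
        √(2 * Real.pi) (HasDeltaPathIntegralAlong (trigCutoff T) Z (gaugeFun γ k) f)
        (1 / √(γ ^ 2 * ∫ τ, k τ ^ 2))
          (HasPathIntegralAlong (fun N => trigCutoff T N ⊓ perp k) Z f)) ∧
    -- with any other exhausting sequence of mode cutoffs
    (∀ (V : ℕ → Submodule ℝ (L2Circle T)) [∀ n, FiniteDimensional ℝ (V n)],
      IsExhaustion ⊤ V → (∀ n, IsTame (V n) f) → ∀ Z : ℕ → ℂ,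
      IntegralsEq
        √(2 * Real.pi) (HasDeltaPathIntegralAlong V Z (gaugeFun γ k) f)
        (1 / √(γ ^ 2 * ∫ τ, k τ ^ 2)) (HasPathIntegralAlong (fun n => V n ⊓ perp k) Z f)) ∧
    -- independently of the choice of orthonormal modes of the two spaces
    ((∀ (V : Submodule ℝ (L2Circle T)) [FiniteDimensional ℝ V], IsTame V f) →
      IntegralsEq
        √(2 * Real.pi) (HasDeltaPathIntegral ⊤ (gaugeFun γ k) f)
        (1 / √(γ ^ 2 * ∫ τ, k τ ^ 2)) (HasPathIntegral (perp k) f)) := by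
  have hw : γ • k ≠ 0 := smul_ne_zero hγ hk
  have h2π : √(2 * Real.pi) ≠ 0 := by positivity
  have hnorm : ‖γ • k‖ ≠ 0 := norm_ne_zero_iff.2 hw
  have along : ∀ (V : ℕ → Submodule ℝ (L2Circle T)) [∀ n, FiniteDimensional ℝ (V n)],
      IsExhaustion ⊤ V → (∀ n, IsTame (V n) f) → ∀ Z : ℕ → ℂ,
      IntegralsEq √(2 * Real.pi) (HasDeltaPathIntegralAlong V Z (gaugeFun γ k) f)
        (1 / √(γ ^ 2 * ∫ τ, k τ ^ 2)) (HasPathIntegralAlong (fun n => V n ⊓ perp k) Z f) := by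
    intro V _ hV hf Z
    rw [sqrt_sq_mul_integral_sq, gaugeFun_eq_inner]
    have hk := perp_eq_orthogonal_smul hγ k
    generalize perp k = K at hk ⊢
    subst hk
    exact integralsEq_of_iff h2π hnorm (fun A => hasDeltaPathIntegralAlong_iff hV hf hw Z)
      fun A B => HasPathIntegralAlong.unique
  refine ⟨along _ (isExhaustion_trigCutoff T), along, fun hf => ?_⟩
  rw [sqrt_sq_mul_integral_sq, gaugeFun_eq_inner, perp_eq_orthogonal_smul hγ k]
  refine integralsEq_of_iff h2π hnorm (fun A => hasDeltaPathIntegral_iff hf hw) fun A B hA hB => ?_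
  -- The intrinsic value is unique only because the hyperplane has some exhaustion; the
  -- trigonometric sections provide one.
  have hex := (isExhaustion_trigCutoff T).inf_orthogonal hw
  exact (hA _ hex).unique (hB _ hex)
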